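/- An instance of Token Jumping is a triple $(G,I,J)$, where $G$ is a finite simple undirected graph and $I,J$ are independent sets of $G$ with $|I|=|J|=k$. It is a Yes-instance if there is a sequence $I=I_1,I_2,\dots,I_\ell=J$ of independent sets of $G$ with $|I_i\setminus I_{i+1}|=|I_{i+1}\setminus I_i|=1$ for all $1\le i<\ell$. Token Jumping, parameterized by $k$, admits a kernel with at most $21k$ vertices on outerplanar graphs (graphs that have a crossing-free drawing in the plane with every vertex on the boundary of the outer face). That is, there is a polynomial-time algorithm that, given an instance $(G,I,J)$ of Token Jumping with $G$ outerplanar and $|I|=|J|=k$, outputs an instance $(G',I',J')$ of Token Jumping such that $G'$ is outerplanar, $|V(G')|\le 21k$, and $(G',I',J')$ is a Yes-instance if and only if $(G,I,J)$ is a Yes-instance. -/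

import Mathlib

/-! ### Outerplanar graphs -/

/-- A crossing-free drawing of `G` in the plane `ℂ`: vertices are distinct points, every edge `uv`
is a simple arc from `u` to `v`, an arc contains no vertex other than its two ends, and two
different arcs meet in vertices only. The value of `arc` at a non-edge is irrelevant. -/
structure PlaneDrawing {V : Type*} (G : SimpleGraph V) where
  /-- the point that represents a vertex -/
  pos : V → ℂ
  /-- the point set of the curve that represents an edge -/
  arc : Sym2 V → Set ℂ
  pos_injective : Function.Injective pos
  arc_simple : ∀ u v, G.Adj u v →
    ∃ γ : Path (pos u) (pos v), Function.Injective γ ∧ Set.range γ = arc s(u, v)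
  mem_of_pos_mem_arc : ∀ e ∈ G.edgeSet, ∀ w, pos w ∈ arc e → w ∈ e
  arc_inter_arc : ∀ e ∈ G.edgeSet, ∀ f ∈ G.edgeSet, e ≠ f → arc e ∩ arc f ⊆ Set.range pos

namespace PlaneDrawing

variable {V : Type*} {G : SimpleGraph V}

/-- The set of all points of the plane that belong to the drawing. -/
def points (D : PlaneDrawing G) : Set ℂ :=
  Set.range D.pos ∪ ⋃ e ∈ G.edgeSet, D.arc e

/-- The outer face: the unbounded connected component of the complement of the drawing
(for a finite graph there is exactly one). -/
def outerFace (D : PlaneDrawing G) : Set ℂ :=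
  {z | z ∈ D.pointsᶜ ∧ ¬ Bornology.IsBounded (connectedComponentIn D.pointsᶜ z)}

end PlaneDrawing

/-- A graph is outerplanar if it has a crossing-free drawing in the plane in which every vertex
lies on the boundary of the outer face. -/
def SimpleGraph.IsOuterplanar {V : Type*} (G : SimpleGraph V) : Prop :=
  ∃ D : PlaneDrawing G, ∀ v, D.pos v ∈ frontier D.outerFace

/-! ### Token Jumping -/

namespace TokenJumping

/-- A single jump: both sets are independent and the second arises from the first by changing the
position of exactly one token. -/
def Step {V : Type*} [DecidableEq V] (G : SimpleGraph V) (A B : Finset V) : Prop :=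
  G.IsIndepSet (A : Set V) ∧ G.IsIndepSet (B : Set V) ∧ (A \ B).card = 1 ∧ (B \ A).card = 1

/-- An instance of Token Jumping: a finite graph with two independent sets of equal size. -/
structure Instance where
  /-- the number of vertices -/
  order : ℕ
  graph : SimpleGraph (Fin order)
  source : Finset (Fin order)
  target : Finset (Fin order)
  source_indep : graph.IsIndepSet (source : Set (Fin order))
  target_indep : graph.IsIndepSet (target : Set (Fin order))
  card_eq : source.card = target.card

/-- The parameter `k`: the common size of the two independent sets. -/
def Instance.param (x : Instance) : ℕ := x.source.card

/-- `x` is a Yes-instance: its two independent sets are TJ-equivalent, i.e. joined by a finite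
(possibly empty) sequence of jumps through independent sets. -/
def Instance.IsYes (x : Instance) : Prop :=
  Relation.ReflTransGen (Step x.graph) x.source x.target

/-- The alphabet in which instances are written down. -/
inductive Symbol : Type
  /-- a vertex, with its membership in the first and in the second independent set -/
  | vertex (inSource inTarget : Bool)
  /-- the beginning of a row of the adjacency matrix -/
  | row
  /-- an entry of the adjacency matrix -/
  | entry (adjacent : Bool)
  deriving DecidableEq, Fintype

open Classical in
/-- The row of the adjacency matrix that belongs to the vertex `u`. -/
noncomputable def Instance.encodeRow (x : Instance) (u : Fin x.order) : List Symbol :=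
  Symbol.row :: List.ofFn fun v => Symbol.entry (decide (x.graph.Adj u v))

/-- The encoding of an instance as a word: the list of the vertices, with their membership in the
two independent sets, followed by the rows of the adjacency matrix. -/
noncomputable def Instance.encode (x : Instance) : List Symbol :=
  (List.ofFn fun v => Symbol.vertex (decide (v ∈ x.source)) (decide (v ∈ x.target))) ++
    (List.ofFn fun u => x.encodeRow u).flatten

/-- Different instances have different encodings. -/
theorem Instance.encode_injective : Function.Injective Instance.encode := by
  classical
  have key : ∀ x : Instance, x.encode.countP
      (fun s => match s with | .vertex _ _ => true | _ => false) = x.order := by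
    intro x
    unfold Instance.encode
    rw [List.countP_append, List.countP_eq_length.2, List.countP_eq_zero.2]
    · simp
    · intro s hs
      simp only [List.mem_flatten, List.mem_ofFn] at hs
      obtain ⟨l, ⟨u, rfl⟩, hs⟩ := hs
      simp only [Instance.encodeRow, List.mem_cons, List.mem_ofFn] at hs
      rcases hs with rfl | ⟨v, rfl⟩ <;> simp
    · intro s hs
      simp only [List.mem_ofFn] at hs
      obtain ⟨v, rfl⟩ := hs
      rfl
  intro x y hxy
  have hn : x.order = y.order := by rw [← key x, ← key y, hxy]
  obtain ⟨n, G, I, J, hI, hJ, hc⟩ := x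
  obtain ⟨m, G', I', J', hI', hJ', hc'⟩ := y
  obtain rfl : n = m := hn
  obtain ⟨h1, h2⟩ := List.append_inj hxy (by simp)
  have h1' := fun v => congrFun (List.ofFn_injective h1) v
  have h2' := List.ofFn_injective ((List.eq_iff_flatten_eq).2 ⟨h2, by
    simp [Instance.encodeRow, List.map_ofFn, Function.comp_def]⟩)
  have hII : I = I' := by
    ext v; have := h1' v; simp at this; exact this.1
  have hJJ : J = J' := by
    ext v; have := h1' v; simp at this; exact this.2
  have hG : G = G' := by
    ext u v
    have := congrFun h2' u
    simp only [Instance.encodeRow, List.cons.injEq, true_and] at this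
    have := congrFun (List.ofFn_injective this) v
    simpa using this
  subst hII hJJ hG
  rfl

/-- `K` is a kernelization algorithm for Token Jumping, parameterized by the size of the
independent sets, on the graphs with the property `P`, whose output has at most `s k` vertices:
`K` is computable in time polynomial in the length of its input and, for an instance whose graph
has the property `P`, yields an equivalent instance whose graph has the property `P` and at most
`s k` vertices. (The parameter of the output is then also at most `s k`, since its independent
sets consist of vertices.) -/
def IsKernelization (P : ∀ n, SimpleGraph (Fin n) → Prop) (s : ℕ → ℕ)
    (K : Instance → Instance) : Prop :=
  Nonempty (Turing.TM2ComputableInPolyTime Instance.encode Instance.encode K) ∧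
  ∀ x : Instance, P x.order x.graph →
    P (K x).order (K x).graph ∧ ((K x).IsYes ↔ x.IsYes) ∧ (K x).order ≤ s x.param

end TokenJumping

/-! The kernel is a size test: if the graph has more than `21 * k` vertices, the answer is Yes and
the empty instance is returned; otherwise the instance is kept. The test needs only two counts, so a
stack machine performs it in linear time (`truncate_polyTime`).

Outerplanarity enters only through the absence of a `K₂,₃`-minor, in the weak form `NoK23`. A point
of the outer face joined to the three vertices of degree two would turn such a minor into a planar
`K₃,₃`. That `K₃,₃` is not planar follows from continuous logarithms of differences of points on
disjoint curves, without the Jordan curve theorem.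

In a `NoK23` graph, let `X = I ∪ J`, so that `|X| ≤ 2k`. At most `2|X| ≤ 4k` vertices outside `X`
have two neighbours in `X` (`NoK23.card_le_two_mul_card`). If there are more than `12k` vertices,
over `6k` remain that have at most one neighbour in `X`, and a sixth of these is independent
(`NoK23.exists_isIndepSet`). Both `I` and `J` can be moved, token by token, onto `k` vertices of
this independent set (`reachable_of_at_most_one_blocker`). -/

/-! ### The angle swept by a curve -/

/-- A continuous zero-free function on a simply connected space has a continuous logarithm. -/
theorem exists_continuous_log {A : Type*} [TopologicalSpace A] [SimplyConnectedSpace A]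
    [LocallyPathConnectedSpace A] {f : A → ℂ} (hf : Continuous f) (h0 : ∀ a, f a ≠ 0) :
    ∃ L : A → ℂ, Continuous L ∧ ∀ a, Complex.exp (L a) = f a := by
  obtain ⟨a₀⟩ : Nonempty A := inferInstance
  obtain ⟨F, ⟨-, hF⟩, -⟩ := Complex.isCoveringMapOn_exp.existsUnique_continuousMap_lifts
    ⟨f, hf⟩ (a₀ := a₀) (e₀ := Complex.log (f a₀)) (by simp [Complex.exp_log (h0 a₀)])
    (by simpa using h0)
  exact ⟨F, F.continuous, fun a => congrFun hF a⟩

/-- Two continuous logarithms of the same function on the line have the same increments. -/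
theorem log_increment_unique {L M : ℝ → ℂ} (hL : Continuous L) (hM : Continuous M)
    {c : ℂ} (h : ∀ t, Complex.exp (L t) = c * Complex.exp (M t)) (s t : ℝ) :
    L t - L s = M t - M s := by
  have hc : c ≠ 0 := by
    rintro rfl
    exact Complex.exp_ne_zero (L 0) (by simp [h])
  -- The two logarithms differ by a constant plus a multiple of `2πi`; this multiple is continuous
  -- and integral, hence constant.
  have hker : ∀ t, ∃ n : ℤ, L t - M t - Complex.log c = n * (2 * Real.pi * Complex.I) := by
    intro t
    rw [← Complex.exp_eq_one_iff, Complex.exp_sub, Complex.exp_sub, h, Complex.exp_log hc]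
    field_simp [Complex.exp_ne_zero]
  choose n hn using hker
  have hpi : (2 * Real.pi * Complex.I : ℂ) ≠ 0 := Complex.two_pi_I_ne_zero
  have hcont : Continuous fun t => ((n t : ℝ)) := by
    have : (fun t => ((n t : ℝ))) =
        fun t => ((L t - M t - Complex.log c) / (2 * Real.pi * Complex.I)).re := by
      funext t
      rw [hn, mul_div_cancel_right₀ _ hpi]
      simp
    rw [this]
    fun_prop
  have hconst : n t = n s := by
    have hn' : Continuous n := by
      rw [Int.isClosedEmbedding_coe_real.isEmbedding.continuous_iff]
      exact hcont
    exact PreconnectedSpace.constant inferInstance hn'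
  have h1 := hn t
  have h2 := hn s
  rw [hconst, ← h2] at h1
  linear_combination h1

/-- A curve that avoids a point has a logarithmic increment as seen from this point: the same
for all continuous logarithms. -/
theorem exists_log_increment {f : ℝ → ℂ} (hf : Continuous f) {v : ℂ} (hv : ∀ t, f t ≠ v) :
    ∃ w : ℂ, Complex.exp w = (f 1 - v) / (f 0 - v) ∧
      ∀ (L : ℝ → ℂ) (c : ℂ), Continuous L → (∀ t, Complex.exp (L t) = c * (f t - v)) →
        L 1 - L 0 = w := by
  obtain ⟨L, hL, hLe⟩ := exists_continuous_log (hf.sub continuous_const)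
    (fun t => sub_ne_zero.2 (hv t))
  refine ⟨L 1 - L 0, by rw [Complex.exp_sub, hLe, hLe]; rfl, fun M c hM hMe => ?_⟩
  exact log_increment_unique hM hL (by simpa [hLe] using hMe) 0 1

/-- The increments of two disjoint curves, as seen from the ends of each other, cancel. -/
theorem log_increment_square {f g : ℝ → ℂ} (hf : Continuous f) (hg : Continuous g)
    (hfg : ∀ s t, f s ≠ g t) {p q r s : ℂ}
    (hp : ∀ (L : ℝ → ℂ) (c : ℂ), Continuous L → (∀ t, Complex.exp (L t) = c * (f t - g 0)) →
        L 1 - L 0 = p)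
    (hq : ∀ (L : ℝ → ℂ) (c : ℂ), Continuous L → (∀ t, Complex.exp (L t) = c * (f t - g 1)) →
        L 1 - L 0 = q)
    (hr : ∀ (L : ℝ → ℂ) (c : ℂ), Continuous L → (∀ t, Complex.exp (L t) = c * (g t - f 0)) →
        L 1 - L 0 = r)
    (hs : ∀ (L : ℝ → ℂ) (c : ℂ), Continuous L → (∀ t, Complex.exp (L t) = c * (g t - f 1)) →
        L 1 - L 0 = s) :
    p - q + s - r = 0 := by
  -- A single logarithm of `f s - g t` on the parameter plane restricts to the four sides of the
  -- unit square, where its increments telescope. The factor `-1` occurs where the difference is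
  -- read as `g - f`.
  obtain ⟨L, hL, hLe⟩ := exists_continuous_log (A := ℝ × ℝ) (f := fun x => f x.1 - g x.2)
    (by fun_prop) (fun x => sub_ne_zero.2 (hfg _ _))
  rw [← hp (fun t => L (t, 0)) 1 (by fun_prop) (by simp [hLe]),
    ← hq (fun t => L (t, 1)) 1 (by fun_prop) (by simp [hLe]),
    ← hr (fun t => L (0, t)) (-1) (by fun_prop) (by simp [hLe]),
    ← hs (fun t => L (1, t)) (-1) (by fun_prop) (by simp [hLe])]
  ring

/-- `K₃,₃` cannot be mapped to the plane such that independent edges have disjoint images. -/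
theorem not_planar_completeBipartite_three_three (a b : Fin 3 → ℂ) (γ : ∀ i j, Path (a i) (b j))
    (h : ∀ i j k l, i ≠ k → j ≠ l → Disjoint (Set.range (γ i j)) (Set.range (γ k l))) :
    False := by
  have hcont : ∀ i j, Continuous (γ i j).extend := fun i j => (γ i j).continuous_extend
  have hd : ∀ i j k l, i ≠ k → j ≠ l → ∀ s t, (γ i j).extend s ≠ (γ k l).extend t := by
    intro i j k l hik hjl s t hst
    have hd := h i j k l hik hjl
    rw [← Path.extend_range, ← Path.extend_range] at hd
    exact Set.disjoint_left.1 hd ⟨s, rfl⟩ ⟨t, hst.symm⟩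
  have hne : ∀ j : Fin 3, ∃ l, j ≠ l := by decide
  have hA : ∀ k i j, ∃ w : ℂ, k ≠ i → Complex.exp w = (b j - a k) / (a i - a k) ∧
      ∀ (L : ℝ → ℂ) (c : ℂ), Continuous L →
        (∀ t, Complex.exp (L t) = c * ((γ i j).extend t - a k)) → L 1 - L 0 = w := by
    intro k i j
    by_cases hki : k = i
    · exact ⟨0, fun h => absurd hki h⟩
    · obtain ⟨l, hl⟩ := hne j
      obtain ⟨w, hw⟩ := exists_log_increment (hcont i j) (v := a k) (fun t => by
        simpa using hd i j k l (Ne.symm hki) hl t 0)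
      exact ⟨w, fun _ => by simpa using hw⟩
  have hB : ∀ l i j, ∃ w : ℂ, l ≠ j →
      ∀ (L : ℝ → ℂ) (c : ℂ), Continuous L →
        (∀ t, Complex.exp (L t) = c * ((γ i j).extend t - b l)) → L 1 - L 0 = w := by
    intro l i j
    by_cases hlj : l = j
    · exact ⟨0, fun h => absurd hlj h⟩
    · obtain ⟨k, hk⟩ := hne i
      obtain ⟨w, hw⟩ := exists_log_increment (hcont i j) (v := b l) (fun t => by
        simpa using hd i j k l hk (Ne.symm hlj) t 1)
      exact ⟨w, fun _ => hw.2⟩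
  choose u hu using hA
  choose v hv using hB
  have hane : ∀ i k, i ≠ k → a i - a k ≠ 0 := by
    intro i k hik
    rw [sub_ne_zero]
    simpa using hd i 0 k 1 hik (by decide) 0 0
  have hbne : ∀ k j, b j - a k ≠ 0 := by
    intro k j
    obtain ⟨i, hi⟩ := hne k
    obtain ⟨l, hl⟩ := hne j
    rw [sub_ne_zero]
    simpa using hd i j k l hi.symm hl 1 0
  have hrel : ∀ i j k l, i ≠ k → j ≠ l → u k i j - v l i j + v j k l - u i k l = 0 := by
    intro i j k l hik hjl
    refine log_increment_square (hcont i j) (hcont k l) (hd i j k l hik hjl) ?_ ?_ ?_ ?_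
    · simpa using (hu k i j hik.symm).2
    · simpa using hv l i j hjl.symm
    · simpa using (hu i k l hik).2
    · simpa using hv j k l hjl
  -- All factors `b j - a k` cancel, and three quotients of the form `(a i - a k) / (a k - a i)`
  -- remain.
  have htri : ∀ j, Complex.exp (u 0 1 j - u 0 2 j + (u 1 2 j - u 1 0 j) + (u 2 0 j - u 2 1 j))
      = -1 := by
    intro j
    have h01 := hane 0 1 (by decide)
    have h02 := hane 0 2 (by decide)
    have h12 := hane 1 2 (by decide)
    have h10 := hane 1 0 (by decide)
    have h20 := hane 2 0 (by decide)
    have h21 := hane 2 1 (by decide)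
    have hb0 := hbne 0 j
    have hb1 := hbne 1 j
    have hb2 := hbne 2 j
    simp only [Complex.exp_add, Complex.exp_sub]
    rw [(hu 0 1 j (by decide)).1, (hu 0 2 j (by decide)).1, (hu 1 2 j (by decide)).1,
      (hu 1 0 j (by decide)).1, (hu 2 0 j (by decide)).1, (hu 2 1 j (by decide)).1]
    field_simp
    ring
  -- Summed over the cyclic pairs `(i, k)` and all `j ≠ l`, the `v`-terms cancel, while every
  -- `u`-term occurs twice; hence the factor `-1 / 2`.
  have hsum : ∑ j, (u 0 1 j - u 0 2 j + (u 1 2 j - u 1 0 j) + (u 2 0 j - u 2 1 j)) = 0 := by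
    have e := fun i k j l (hik : i ≠ k) (hjl : j ≠ l) => hrel i j k l hik hjl
    have e1 := e 0 1 0 1 (by decide) (by decide)
    have e2 := e 0 1 0 2 (by decide) (by decide)
    have e3 := e 0 1 1 0 (by decide) (by decide)
    have e4 := e 0 1 1 2 (by decide) (by decide)
    have e5 := e 0 1 2 0 (by decide) (by decide)
    have e6 := e 0 1 2 1 (by decide) (by decide)
    have f1 := e 1 2 0 1 (by decide) (by decide)
    have f2 := e 1 2 0 2 (by decide) (by decide)
    have f3 := e 1 2 1 0 (by decide) (by decide)
    have f4 := e 1 2 1 2 (by decide) (by decide)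
    have f5 := e 1 2 2 0 (by decide) (by decide)
    have f6 := e 1 2 2 1 (by decide) (by decide)
    have g1 := e 2 0 0 1 (by decide) (by decide)
    have g2 := e 2 0 0 2 (by decide) (by decide)
    have g3 := e 2 0 1 0 (by decide) (by decide)
    have g4 := e 2 0 1 2 (by decide) (by decide)
    have g5 := e 2 0 2 0 (by decide) (by decide)
    have g6 := e 2 0 2 1 (by decide) (by decide)
    simp only [Fin.sum_univ_three]
    linear_combination (-1 / 2 : ℂ) * (e1 + e2 + e3 + e4 + e5 + e6 + f1 + f2 + f3 + f4 + f5 + f6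
      + g1 + g2 + g3 + g4 + g5 + g6)
  -- The contradiction is `(-1) ^ 3 = 1`.
  have := congrArg Complex.exp hsum
  rw [Complex.exp_sum] at this
  simp only [htri, Finset.prod_const, Finset.card_univ, Fintype.card_fin, Complex.exp_zero] at this
  norm_num at this

/-! ### Graphs without `K₂,₃`-minor -/

namespace SimpleGraph

variable {V : Type*}

/-- `G` has no minor `K₂,₃` in which only the two vertices of degree three may arise by
contraction. -/
def NoK23 (G : SimpleGraph V) : Prop :=
  ∀ (A B : Set V) (p : Fin 3 → V), (G.induce A).Connected → (G.induce B).Connected →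
    Disjoint A B → Function.Injective p → (∀ i, p i ∉ A) → (∀ i, p i ∉ B) →
    (∀ i, ∃ a ∈ A, G.Adj a (p i)) → (∀ i, ∃ b ∈ B, G.Adj b (p i)) → False

variable {G : SimpleGraph V}

theorem induce_singleton_connected (G : SimpleGraph V) (v : V) :
    (G.induce ({v} : Set V)).Connected :=
  have : Nonempty ({v} : Set V) := ⟨⟨v, rfl⟩⟩
  ⟨fun x y => by rw [Subsingleton.elim x y]⟩

/-- At most two vertices are adjacent to each of two disjoint connected sets. -/
theorem NoK23.card_common_neighbors_le (hG : G.NoK23) {A B : Set V}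
    (hA : (G.induce A).Connected) (hB : (G.induce B).Connected) (hAB : Disjoint A B)
    {D : Finset V} (hD : ∀ d ∈ D, d ∉ A ∧ d ∉ B ∧ (∃ a ∈ A, G.Adj a d) ∧ ∃ b ∈ B, G.Adj b d) :
    D.card ≤ 2 := by
  by_contra! h
  obtain ⟨E, hED, hE⟩ := Finset.exists_subset_card_eq (Nat.succ_le_of_lt h)
  have e := (E.equivFinOfCardEq hE).symm
  have hp : ∀ i, (e i : V) ∈ D := fun i => hED (e i).2
  exact hG A B (fun i => e i) hA hB hAB (Subtype.val_injective.comp e.injective)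
    (fun i => (hD _ (hp i)).1) (fun i => (hD _ (hp i)).2.1) (fun i => (hD _ (hp i)).2.2.1)
    (fun i => (hD _ (hp i)).2.2.2)

/-- If every vertex of `C` has neighbours in two of `n` disjoint connected sets that avoid `C`,
then `C` has at most `2 * n` vertices: merging two of the sets along a vertex of `C` spoils at
most two vertices of `C`. -/
theorem NoK23.card_le_two_mul_card_parts (hG : G.NoK23) (n : ℕ) :
    ∀ (P : Finset (Set V)) (C : Finset V), P.card ≤ n →
      (P : Set (Set V)).PairwiseDisjoint id → (∀ A ∈ P, (G.induce A).Connected) →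
      (∀ A ∈ P, ∀ c ∈ C, c ∉ A) →
      (∀ c ∈ C, ∃ A ∈ P, ∃ B ∈ P, A ≠ B ∧ (∃ a ∈ A, G.Adj a c) ∧ ∃ b ∈ B, G.Adj b c) →
      C.card ≤ 2 * n := by
  classical
  induction n with
  | zero =>
    intro P C hP _ _ _ hC
    rw [Nat.le_zero, Finset.card_eq_zero] at hP
    subst hP
    rw [Nat.mul_zero, Nat.le_zero, Finset.card_eq_zero, Finset.eq_empty_iff_forall_notMem]
    intro c hc
    obtain ⟨A, hA, -⟩ := hC c hc
    exact absurd hA (Finset.notMem_empty A)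
  | succ n ih =>
    intro P C hP hdis hconn hPC hC
    obtain rfl | ⟨c, hc⟩ := C.eq_empty_or_nonempty
    · simp
    obtain ⟨A, hA, B, hB, hne, ⟨a, ha, hac⟩, b, hb, hbc⟩ := hC c hc
    set D := C.filter fun d => (∃ a ∈ A, G.Adj a d) ∧ ∃ b ∈ B, G.Adj b d with hDdef
    have hDcard : D.card ≤ 2 := by
      refine hG.card_common_neighbors_le (hconn A hA) (hconn B hB) (hdis hA hB hne) fun d hd => ?_
      rw [hDdef, Finset.mem_filter] at hd
      exact ⟨hPC A hA d hd.1, hPC B hB d hd.1, hd.2⟩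
    have hcD : c ∈ D := Finset.mem_filter.2 ⟨hc, ⟨a, ha, hac⟩, b, hb, hbc⟩
    set M : Set V := A ∪ {c} ∪ B with hM
    have hMconn : (G.induce M).Connected := by
      have h1 : (G.induce (A ∪ {a, c})).Connected :=
        induce_union_connected (hconn A hA).preconnected
          (induce_pair_connected_of_adj hac).preconnected ⟨a, ha, by simp⟩
      have h2 : (G.induce (B ∪ {b, c})).Connected :=
        induce_union_connected (hconn B hB).preconnected
          (induce_pair_connected_of_adj hbc).preconnected ⟨b, hb, by simp⟩
      have h3 := induce_union_connected h1.preconnected h2.preconnected ⟨c, by simp⟩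
      have : A ∪ {a, c} ∪ (B ∪ {b, c}) = M := by
        ext x
        simp only [Set.mem_union, Set.mem_insert_iff, Set.mem_singleton_iff, hM]
        constructor
        · rintro ((h | rfl | h) | (h | rfl | h)) <;> tauto
        · tauto
      rwa [this] at h3
    set Q := (P.erase A).erase B with hQ
    have hQP : ∀ E ∈ Q, E ∈ P ∧ E ≠ A ∧ E ≠ B := by
      intro E hE
      simp only [hQ, Finset.mem_erase] at hE
      exact ⟨hE.2.2, hE.2.1, hE.1⟩
    have hQcard : Q.card + 2 = P.card := by
      have h1 := Finset.card_erase_add_one hA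
      have h2 := Finset.card_erase_add_one (Finset.mem_erase.2 ⟨hne.symm, hB⟩)
      rw [hQ]; lia
    have hMQ : ∀ E ∈ Q, Disjoint M E := by
      intro E hE
      obtain ⟨hEP, hEA, hEB⟩ := hQP E hE
      rw [hM, Set.disjoint_union_left, Set.disjoint_union_left]
      exact ⟨⟨hdis hA hEP hEA.symm, Set.disjoint_singleton_left.2 (hPC E hEP c hc)⟩,
        hdis hB hEP hEB.symm⟩
    have key : (C \ D).card ≤ 2 * n := by
      refine ih (insert M Q) (C \ D) ?_ ?_ ?_ ?_ ?_
      · have := Finset.card_insert_le M Q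
        lia
      · rw [Finset.coe_insert]
        refine Set.PairwiseDisjoint.insert ?_ fun E hE _ => hMQ E hE
        exact hdis.subset fun E hE => (hQP E hE).1
      · intro E hE
        obtain rfl | hE := Finset.mem_insert.1 hE
        · exact hMconn
        · exact hconn E (hQP E hE).1
      · intro E hE d hd
        rw [Finset.mem_sdiff] at hd
        obtain rfl | hE := Finset.mem_insert.1 hE
        · rintro ((h | h) | h)
          · exact hPC A hA d hd.1 h
          · rw [Set.mem_singleton_iff] at h
            exact hd.2 (h ▸ hcD)
          · exact hPC B hB d hd.1 h
        · exact hPC E (hQP E hE).1 d hd.1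
      · intro d hd
        rw [Finset.mem_sdiff] at hd
        have hnot : ¬ ((∃ a ∈ A, G.Adj a d) ∧ ∃ b ∈ B, G.Adj b d) := fun h =>
          hd.2 (Finset.mem_filter.2 ⟨hd.1, h⟩)
        have hmem : ∀ E ∈ P, E ≠ A → E ≠ B → E ∈ Q := fun E hE h1 h2 =>
          Finset.mem_erase.2 ⟨h2, Finset.mem_erase.2 ⟨h1, hE⟩⟩
        have hAM : ∀ x ∈ A, x ∈ M := fun x hx => Or.inl (Or.inl hx)
        have hBM : ∀ x ∈ B, x ∈ M := fun x hx => Or.inr hx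
        have hlift : ∀ E ∈ P, (∃ x ∈ E, G.Adj x d) → (E = A ∨ E = B) → ∃ x ∈ M, G.Adj x d := by
          rintro E - ⟨x, hx, hxd⟩ (rfl | rfl)
          · exact ⟨x, hAM x hx, hxd⟩
          · exact ⟨x, hBM x hx, hxd⟩
        have hne' : ∀ E ∈ Q, M ≠ E := by
          rintro E hE rfl
          exact (hMQ _ hE).ne_of_mem (hAM a ha) (hAM a ha) rfl
        obtain ⟨E, hE, F, hF, hEF, hEd, hFd⟩ := hC d hd.1
        -- A vertex outside `D` does not see both `A` and `B`, so its two parts remain different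
        -- after the merging.
        by_cases h1 : E = A ∨ E = B
        · have h2 : ¬ (F = A ∨ F = B) := by
            rintro (rfl | rfl) <;> rcases h1 with rfl | rfl
            · exact hEF rfl
            · exact hnot ⟨hFd, hEd⟩
            · exact hnot ⟨hEd, hFd⟩
            · exact hEF rfl
          push Not at h2
          have hFQ := hmem F hF h2.1 h2.2
          exact ⟨M, Finset.mem_insert_self _ _, F, Finset.mem_insert_of_mem hFQ, hne' F hFQ,
            hlift E hE hEd h1, hFd⟩
        · by_cases h2 : F = A ∨ F = B
          · push Not at h1
            have hEQ := hmem E hE h1.1 h1.2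
            exact ⟨M, Finset.mem_insert_self _ _, E, Finset.mem_insert_of_mem hEQ, hne' E hEQ,
              hlift F hF hFd h2, hEd⟩
          · push Not at h1 h2
            exact ⟨E, Finset.mem_insert_of_mem (hmem E hE h1.1 h1.2),
              F, Finset.mem_insert_of_mem (hmem F hF h2.1 h2.2), hEF, hEd, hFd⟩
    have := Finset.card_sdiff_add_card_eq_card (Finset.filter_subset _ C : D ⊆ C)
    lia

/-- If every vertex of `C` has two neighbours in `S`, and `C` is disjoint from `S`, then
`C` has at most `2 * |S|` vertices. -/
theorem NoK23.card_le_two_mul_card (hG : G.NoK23) {S C : Finset V} (hSC : Disjoint S C)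
    (hC : ∀ c ∈ C, ∃ x ∈ S, ∃ y ∈ S, x ≠ y ∧ G.Adj x c ∧ G.Adj y c) :
    C.card ≤ 2 * S.card := by
  classical
  refine hG.card_le_two_mul_card_parts S.card (S.image fun x => {x}) C Finset.card_image_le
    ?_ ?_ ?_ ?_
  · intro A hA B hB hAB
    simp only [Finset.coe_image, Set.mem_image, Finset.mem_coe] at hA hB
    obtain ⟨x, -, rfl⟩ := hA
    obtain ⟨y, -, rfl⟩ := hB
    exact Set.disjoint_singleton.2 fun h => hAB (by rw [h])
  · intro A hA
    obtain ⟨x, -, rfl⟩ := Finset.mem_image.1 hA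
    exact G.induce_singleton_connected x
  · intro A hA c hc hcA
    obtain ⟨x, hx, rfl⟩ := Finset.mem_image.1 hA
    rw [Set.mem_singleton_iff] at hcA
    exact Finset.disjoint_left.1 hSC hx (hcA ▸ hc)
  · intro c hc
    obtain ⟨x, hx, y, hy, hxy, h1, h2⟩ := hC c hc
    exact ⟨{x}, Finset.mem_image_of_mem _ hx, {y}, Finset.mem_image_of_mem _ hy,
      fun h => hxy (Set.singleton_injective h), ⟨x, rfl, h1⟩, y, rfl, h2⟩

/-- A clique in the neighbourhood of a vertex has at most three vertices. -/
theorem NoK23.card_clique_neighbors_le (hG : G.NoK23) {s : V} {T : Finset V}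
    (hT : G.IsClique (T : Set V)) (hs : ∀ t ∈ T, G.Adj s t) : T.card ≤ 3 := by
  classical
  obtain rfl | ⟨v, hv⟩ := T.eq_empty_or_nonempty
  · simp
  -- The members of `T` other than `v` are common neighbours of `s` and `v`.
  have h := hG.card_common_neighbors_le (G.induce_singleton_connected s)
    (G.induce_singleton_connected v) (Set.disjoint_singleton.2 (hs v hv).ne) (D := T.erase v)
    fun d hd => by
      rw [Finset.mem_erase] at hd
      exact ⟨fun h => (hs d hd.2).ne h.symm, hd.1, ⟨s, rfl, hs d hd.2⟩,
        v, rfl, hT hv hd.2 hd.1.symm⟩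
  have := Finset.card_erase_add_one hv
  lia

/-- Every set of vertices contains an independent set of at least a sixth of its size. -/
theorem NoK23.exists_isIndepSet (hG : G.NoK23) (H : Finset V) :
    ∃ S ⊆ H, G.IsIndepSet (S : Set V) ∧ H.card ≤ 6 * S.card := by
  classical
  obtain ⟨S, hS, hmax⟩ := Finset.exists_max_image
    (H.powerset.filter fun S : Finset V => G.IsIndepSet (S : Set V)) Finset.card
    ⟨∅, by simp [IsIndepSet]⟩
  simp only [Finset.mem_filter, Finset.mem_powerset] at hS hmax
  obtain ⟨hSH, hSind⟩ := hS
  refine ⟨S, hSH, hSind, ?_⟩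
  -- Since `S` is maximum, each vertex of `H \ S` has two neighbours in `S` or is a private
  -- neighbour of some `s`. The first kind `C` contributes at most `2 * S.card` and each `T s` at
  -- most `3`, which gives `1 + 2 + 3 = 6`.
  set C := (H \ S).filter fun c => ∃ x ∈ S, ∃ y ∈ S, x ≠ y ∧ G.Adj x c ∧ G.Adj y c with hC
  set T : V → Finset V := fun s => (H \ S).filter fun c => G.Adj s c ∧ ∀ y ∈ S, G.Adj y c → y = s
    with hT
  have hCcard : C.card ≤ 2 * S.card := by
    refine hG.card_le_two_mul_card ?_ fun c hc => (Finset.mem_filter.1 hc).2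
    rw [Finset.disjoint_left]
    intro x hx hxC
    exact (Finset.mem_sdiff.1 (Finset.mem_filter.1 hxC).1).2 hx
  have hTcard : ∀ s ∈ S, (T s).card ≤ 3 := by
    intro s hs
    refine hG.card_clique_neighbors_le (s := s) ?_ fun t ht => (Finset.mem_filter.1 ht).2.1
    intro c hc d hd hcd
    by_contra hnadj
    simp only [hT, Finset.coe_filter, Finset.mem_sdiff, Set.mem_ofPred_eq] at hc hd
    have hcd' : c ∉ insert d (S.erase s) := by
      simp only [Finset.mem_insert, Finset.mem_erase, not_or, not_and]
      exact ⟨hcd, fun _ => hc.1.2⟩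
    have hd' : d ∉ S.erase s := fun h => hd.1.2 (Finset.mem_of_mem_erase h)
    -- Two non-adjacent private neighbours of `s` could replace `s` and enlarge `S`; hence `T s` is
    -- a clique.
    have := hmax (insert c (insert d (S.erase s))) ⟨?_, ?_⟩
    · rw [Finset.card_insert_of_notMem hcd', Finset.card_insert_of_notMem hd',
        Finset.card_erase_add_one hs] at this
      lia
    · intro x hx
      simp only [Finset.mem_insert, Finset.mem_erase] at hx
      rcases hx with rfl | rfl | hx
      exacts [hc.1.1, hd.1.1, hSH hx.2]
    · have hfree : ∀ e, (∀ y ∈ S, G.Adj y e → y = s) → ∀ y ∈ S, y ≠ s → ¬ G.Adj e y :=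
        fun e he y hy hys h => hys (he y hy h.symm)
      rw [Finset.coe_insert, Finset.coe_insert, Finset.coe_erase]
      refine Set.Pairwise.insert (Set.Pairwise.insert (hSind.mono Set.sdiff_subset) ?_) ?_
      · rintro y ⟨hy, hys⟩ -
        exact ⟨hfree d hd.2.2 y hy hys, fun h => hfree d hd.2.2 y hy hys h.symm⟩
      · rintro y (rfl | ⟨hy, hys⟩) -
        · exact ⟨hnadj, fun h => hnadj h.symm⟩
        · exact ⟨hfree c hc.2.2 y hy hys, fun h => hfree c hc.2.2 y hy hys h.symm⟩
  have hcover : H ⊆ S ∪ (C ∪ S.biUnion T) := by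
    intro c hc
    rw [Finset.mem_union, Finset.mem_union, Finset.mem_biUnion]
    by_cases hcS : c ∈ S
    · exact Or.inl hcS
    right
    have hcHS : c ∈ H \ S := Finset.mem_sdiff.2 ⟨hc, hcS⟩
    have hex : ∃ s ∈ S, G.Adj s c := by
      by_contra! hno
      have := hmax (insert c S) ⟨Finset.insert_subset hc hSH, ?_⟩
      · rw [Finset.card_insert_of_notMem hcS] at this
        lia
      · rw [Finset.coe_insert]
        exact hSind.insert fun y hy _ => ⟨fun h => hno y hy h.symm, hno y hy⟩
    obtain ⟨s, hs, hsc⟩ := hex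
    by_cases huniq : ∀ y ∈ S, G.Adj y c → y = s
    · exact Or.inr ⟨s, hs, Finset.mem_filter.2 ⟨hcHS, hsc, huniq⟩⟩
    · push Not at huniq
      obtain ⟨y, hy, hyc, hys⟩ := huniq
      exact Or.inl (Finset.mem_filter.2 ⟨hcHS, s, hs, y, hy, hys.symm, hsc, hyc⟩)
  have h1 := Finset.card_le_card hcover
  have h2 := Finset.card_union_le S (C ∪ S.biUnion T)
  have h3 := Finset.card_union_le C (S.biUnion T)
  have h4 := Finset.card_biUnion_le_card_mul S T 3 hTcard
  lia

end SimpleGraph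

/-! ### Outerplanar graphs have no `K₂,₃`-minor -/

theorem isPreconnected_norm_gt (R : ℝ) : IsPreconnected {z : ℂ | R < ‖z‖} := by
  by_cases hR : 0 ≤ R
  · have h : {z : ℂ | R < ‖z‖} =
        (fun x : ℝ × ℝ => (x.1 : ℂ) * Complex.exp (x.2 * Complex.I)) '' (Set.Ioi R ×ˢ Set.univ) := by
      ext z
      constructor
      · intro hz
        exact ⟨(‖z‖, z.arg), ⟨hz, trivial⟩, Complex.norm_mul_exp_arg_mul_I z⟩
      · rintro ⟨⟨r, t⟩, ⟨hr, -⟩, rfl⟩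
        rw [Set.mem_Ioi] at hr
        simp only [Set.mem_ofPred_eq, norm_mul, Complex.norm_real, Complex.norm_exp_ofReal_mul_I,
          mul_one, Real.norm_eq_abs]
        exact hr.trans_le (le_abs_self r)
    rw [h]
    exact (isPreconnected_Ioi.prod isPreconnected_univ).image _ (by fun_prop)
  · have h : {z : ℂ | R < ‖z‖} = Set.univ :=
      Set.eq_univ_of_forall fun z => (not_le.1 hR).trans_le (norm_nonneg z)
    rw [h]
    exact isPreconnected_univ

/-! ### Subdrawings and access to vertices from the outer face -/

namespace PlaneDrawing

variable {V : Type*} {G : SimpleGraph V} (D : PlaneDrawing G)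

/-- The part of a drawing that belongs to the subgraph induced by `W`. -/
def induced (W : Set V) : Set ℂ :=
  D.pos '' W ∪ ⋃ e ∈ {e ∈ G.edgeSet | ∀ v ∈ e, v ∈ W}, D.arc e

theorem isCompact_arc {e : Sym2 V} (he : e ∈ G.edgeSet) : IsCompact (D.arc e) := by
  induction e with
  | _ u v =>
    obtain ⟨γ, -, hγ⟩ := D.arc_simple u v he
    rw [← hγ]
    exact isCompact_range γ.continuous

theorem induced_univ : D.induced Set.univ = D.points := by
  simp [induced, points]

theorem induced_mono {W W' : Set V} (h : W ⊆ W') : D.induced W ⊆ D.induced W' :=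
  Set.union_subset_union (Set.image_mono h)
    (Set.biUnion_subset_biUnion_left fun _ he => ⟨he.1, fun v hv => h (he.2 v hv)⟩)

theorem induced_subset_points (W : Set V) : D.induced W ⊆ D.points :=
  D.induced_univ ▸ D.induced_mono (Set.subset_univ W)

theorem isCompact_induced [Finite V] (W : Set V) : IsCompact (D.induced W) :=
  (W.toFinite.image _).isCompact.union
    ((Set.toFinite _).isCompact_biUnion fun _ he => D.isCompact_arc he.1)

theorem isCompact_points [Finite V] : IsCompact D.points :=
  D.induced_univ ▸ D.isCompact_induced Set.univ

theorem mem_of_pos_mem_induced {W : Set V} {w : V} (h : D.pos w ∈ D.induced W) : w ∈ W := by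
  rcases h with ⟨v, hv, hvw⟩ | h
  · exact D.pos_injective hvw ▸ hv
  · simp only [Set.mem_iUnion] at h
    obtain ⟨e, he, hwe⟩ := h
    exact he.2 w (D.mem_of_pos_mem_arc e he.1 w hwe)

/-- Different arcs meet only in vertices, and an arc contains no vertex except its ends, so a common
point would be a vertex of both sets. -/
theorem disjoint_induced {W W' : Set V} (h : Disjoint W W') :
    Disjoint (D.induced W) (D.induced W') := by
  rw [Set.disjoint_left]
  intro z hz hz'
  have key : z ∉ Set.range D.pos := by
    rintro ⟨w, rfl⟩
    exact Set.disjoint_left.1 h (D.mem_of_pos_mem_induced hz) (D.mem_of_pos_mem_induced hz')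
  rcases hz with ⟨v, -, rfl⟩ | hz
  · exact key ⟨v, rfl⟩
  rcases hz' with ⟨v, -, rfl⟩ | hz'
  · exact key ⟨v, rfl⟩
  simp only [Set.mem_iUnion] at hz hz'
  obtain ⟨e, he, hze⟩ := hz
  obtain ⟨f, hf, hzf⟩ := hz'
  refine key (D.arc_inter_arc e he.1 f hf.1 ?_ ⟨hze, hzf⟩)
  rintro rfl
  induction e with
  | _ u v => exact Set.disjoint_left.1 h (he.2 u (by simp)) (hf.2 u (by simp))

theorem joinedIn_induced_of_adj {W : Set V} {u v : V} (hu : u ∈ W) (hv : v ∈ W)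
    (h : G.Adj u v) : JoinedIn (D.induced W) (D.pos u) (D.pos v) := by
  obtain ⟨γ, -, hγ⟩ := D.arc_simple u v h
  refine ⟨γ, fun t => Or.inr ?_⟩
  refine Set.mem_biUnion (x := s(u, v)) ⟨h, ?_⟩ (hγ ▸ Set.mem_range_self t)
  intro w hw
  rcases Sym2.mem_iff.1 hw with rfl | rfl <;> assumption

theorem joinedIn_induced {W : Set V} (hW : (G.induce W).Preconnected) {u v : V} (hu : u ∈ W)
    (hv : v ∈ W) : JoinedIn (D.induced W) (D.pos u) (D.pos v) := by
  have h := SimpleGraph.reachable_iff_reflTransGen _ _ |>.1 (hW ⟨u, hu⟩ ⟨v, hv⟩)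
  suffices ∀ x : W, Relation.ReflTransGen (G.induce W).Adj ⟨u, hu⟩ x →
      JoinedIn (D.induced W) (D.pos u) (D.pos x) from this _ h
  intro x hx
  induction hx with
  | refl => exact JoinedIn.refl (Or.inl ⟨u, hu, rfl⟩)
  | tail _ hyz ih => exact ih.trans (D.joinedIn_induced_of_adj (Subtype.prop _) (Subtype.prop _) hyz)

/-- This supplies the edge of `K₃,₃` from a contracted set, represented by its vertex `a`, to `p`.
-/
theorem joinedIn_induced_insert {A : Set V} (hA : (G.induce A).Preconnected) {a p : V}
    (ha : a ∈ A) (hp : ∃ x ∈ A, G.Adj x p) :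
    JoinedIn (D.induced (insert p A)) (D.pos a) (D.pos p) := by
  obtain ⟨x, hx, hxp⟩ := hp
  exact ((D.joinedIn_induced hA ha hx).mono (D.induced_mono (Set.subset_insert p A))).trans
    (D.joinedIn_induced_of_adj (Set.mem_insert_of_mem p hx) (Set.mem_insert p A) hxp)

/-- The outer face of a drawing of a finite graph is a single component. -/
theorem outerFace_eq_connectedComponentIn [Finite V] {z : ℂ} (hz : z ∈ D.outerFace) :
    D.outerFace = connectedComponentIn D.pointsᶜ z := by
  obtain ⟨R, hR⟩ := D.isCompact_points.isBounded.subset_closedBall 0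
  have hE : {w : ℂ | R < ‖w‖} ⊆ D.pointsᶜ := by
    intro w hw hwD
    have := hR hwD
    rw [mem_closedBall_zero_iff] at this
    exact absurd hw (not_lt.2 this)
  -- An unbounded component meets the connected exterior of a disc that contains the drawing, hence
  -- contains all of it.
  have key : ∀ x ∈ D.outerFace, {w : ℂ | R < ‖w‖} ⊆ connectedComponentIn D.pointsᶜ x := by
    intro x hx
    have : ∃ w ∈ connectedComponentIn D.pointsᶜ x, R < ‖w‖ := by
      by_contra! h
      exact hx.2 ((Metric.isBounded_closedBall (x := 0) (r := R)).subset fun w hw =>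
        mem_closedBall_zero_iff.2 (h w hw))
    obtain ⟨w, hw, hwR⟩ := this
    rw [connectedComponentIn_eq hw]
    exact (isPreconnected_norm_gt R).subset_connectedComponentIn hwR hE
  obtain ⟨w, hw⟩ : ∃ w : ℂ, R < ‖w‖ := NormedSpace.exists_lt_norm ℂ ℂ R
  ext x
  constructor
  · intro hx
    rw [connectedComponentIn_eq (key z hz hw), ← connectedComponentIn_eq (key x hx hw)]
    exact mem_connectedComponentIn hx.1
  · intro hx
    refine ⟨connectedComponentIn_subset _ _ hx, ?_⟩
    rw [← connectedComponentIn_eq hx]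
    exact hz.2

theorem isPathConnected_outerFace [Finite V] {z : ℂ} (hz : z ∈ D.outerFace) :
    IsPathConnected D.outerFace := by
  have hopen : IsOpen D.pointsᶜ := D.isCompact_points.isClosed.isOpen_compl
  rw [D.outerFace_eq_connectedComponentIn hz,
    ← hopen.connectedComponentIn.isConnected_iff_isPathConnected]
  exact isConnected_connectedComponentIn_iff.2 hz.1

theorem disjoint_induced_outerFace (W : Set V) : Disjoint (D.induced W) D.outerFace :=
  Set.disjoint_left.2 fun _ hx hxF => hxF.1 (D.induced_subset_points W hx)

/-- A vertex on the boundary of the outer face can be joined to the outer face without touching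
the part of the drawing that avoids this vertex. -/
theorem exists_joinedIn_outerFace [Finite V] {z : ℂ} (hz : z ∈ D.outerFace) {p : V}
    (hp : D.pos p ∈ frontier D.outerFace) :
    ∃ U : Set ℂ, JoinedIn U z (D.pos p) ∧ ∀ W : Set V, p ∉ W → Disjoint (D.induced W) U := by
  -- A small disc around `p` meets only arcs that end in `p`; the connection goes through the outer
  -- face into this disc and then straight to `p`.
  have hclosed : IsClosed (D.induced {p}ᶜ) := (D.isCompact_induced _).isClosed
  have hpn : D.pos p ∈ (D.induced {p}ᶜ)ᶜ := fun h => D.mem_of_pos_mem_induced h rfl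
  obtain ⟨ε, hε, hball⟩ := Metric.isOpen_iff.1 hclosed.isOpen_compl _ hpn
  obtain ⟨y, hy, hyε⟩ := Metric.mem_closure_iff.1 (frontier_subset_closure hp) ε hε
  refine ⟨D.outerFace ∪ Metric.ball (D.pos p) ε, ?_, fun W hW => ?_⟩
  · refine (((D.isPathConnected_outerFace hz).joinedIn z hz y hy).mono
      Set.subset_union_left).trans (JoinedIn.of_segment_subset ?_)
    refine ((convex_ball (D.pos p) ε).segment_subset ?_ ?_).trans Set.subset_union_right
    · rwa [Metric.mem_ball, dist_comm]
    · exact Metric.mem_ball_self hε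
  · refine Set.disjoint_union_right.2 ⟨D.disjoint_induced_outerFace W, ?_⟩
    refine Set.disjoint_left.2 fun x hx hxb => hball hxb (D.induced_mono ?_ hx)
    rintro w hw rfl
    exact hW hw

end PlaneDrawing

/-- `K₃,₃` cannot be mapped to the plane such that independent edges run in disjoint sets. -/
theorem not_joinedIn_completeBipartite_three_three (a b : Fin 3 → ℂ) (U : Fin 3 → Fin 3 → Set ℂ)
    (hU : ∀ i j, JoinedIn (U i j) (a i) (b j))
    (h : ∀ i j k l, i < k → j ≠ l → Disjoint (U i j) (U k l)) : False := by
  refine not_planar_completeBipartite_three_three a b (fun i j => (hU i j).somePath) ?_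
  intro i j k l hik hjl
  have hsub : ∀ i j, Set.range (hU i j).somePath ⊆ U i j := by
    rintro i j _ ⟨t, rfl⟩
    exact (hU i j).somePath_mem t
  refine Disjoint.mono (hsub i j) (hsub k l) ?_
  rcases lt_or_gt_of_ne hik with hlt | hlt
  · exact h i j k l hlt hjl
  · exact (h k l i j hlt hjl.symm).symm

/-- A point `z` of the outer face acts as a third vertex beside the contracted `A` and `B`, and the
`p j` form the other side of a `K₃,₃`. The connections from `z` may overlap each other, since only
independent edges must be disjoint. -/
theorem SimpleGraph.IsOuterplanar.noK23 {V : Type*} [Finite V] {G : SimpleGraph V}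
    (hG : G.IsOuterplanar) : G.NoK23 := by
  obtain ⟨D, hD⟩ := hG
  intro A B p hA hB hAB hp hpA hpB hAp hBp
  obtain ⟨⟨a, ha⟩⟩ := hA.nonempty
  obtain ⟨⟨b, hb⟩⟩ := hB.nonempty
  obtain ⟨z, hz⟩ : D.outerFace.Nonempty := by
    rw [Set.nonempty_iff_ne_empty]
    intro h
    have := hD a
    rw [h, frontier_empty] at this
    exact this
  choose U hU hUd using fun j => D.exists_joinedIn_outerFace hz (hD (p j))
  have hdis : ∀ {E : Set V} {j l : Fin 3}, (∀ i, p i ∉ E) → j ≠ l → p l ∉ insert (p j) E := by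
    rintro E j l hE hjl (h | h)
    · exact hjl (hp h.symm)
    · exact hE l h
  refine not_joinedIn_completeBipartite_three_three ![D.pos a, D.pos b, z] (fun j => D.pos (p j))
    ![fun j => D.induced (insert (p j) A), fun j => D.induced (insert (p j) B), U] ?_ ?_
  · intro i j
    fin_cases i
    · exact D.joinedIn_induced_insert hA.preconnected ha (hAp j)
    · exact D.joinedIn_induced_insert hB.preconnected hb (hBp j)
    · exact hU j
  · intro i j k l hik hjl
    have h01 : Disjoint (D.induced (insert (p j) A)) (D.induced (insert (p l) B)) := by
      apply D.disjoint_induced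
      rw [Set.disjoint_insert_left, Set.disjoint_insert_right]
      exact ⟨hdis hpB hjl.symm, hpA l, hAB⟩
    have h02 := hUd l _ (hdis hpA hjl)
    have h12 := hUd l _ (hdis hpB hjl)
    fin_cases i <;> fin_cases k <;> first | exact h01 | exact h02 | exact h12 | simp at hik

/-! ### Large outerplanar instances are Yes-instances -/

namespace TokenJumping

/-! ### Moving tokens onto a weakly blocked independent set -/

section Reconfiguration

variable {V : Type*} [DecidableEq V] {G : SimpleGraph V}

theorem Step.symm {A B : Finset V} (h : Step G A B) : Step G B A :=
  ⟨h.2.1, h.1, h.2.2.2, h.2.2.1⟩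

/-- The tokens can move from `I` to an independent set `S` of the same size if every vertex of
`S` is blocked by at most one token. -/
theorem reachable_of_at_most_one_blocker (n : ℕ) : ∀ {I S : Finset V},
    (S \ I).card = n → G.IsIndepSet (I : Set V) → G.IsIndepSet (S : Set V) → I.card = S.card →
    (∀ s ∈ S, ∀ x ∈ I, ∀ y ∈ I, G.Adj s x → G.Adj s y → x = y) →
    Relation.ReflTransGen (Step G) I S := by
  induction n with
  | zero =>
    intro I S hn _ _ hcard _
    rw [Finset.card_eq_zero, Finset.sdiff_eq_empty_iff_subset] at hn
    rw [Finset.eq_of_subset_of_card_le hn hcard.le]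
  | succ n ih =>
    intro I S hn hI hS hcard hblock
    obtain ⟨s, hs⟩ : (S \ I).Nonempty := Finset.card_pos.1 (by lia)
    obtain ⟨hsS, hsI⟩ := Finset.mem_sdiff.1 hs
    -- The token to move onto `s` is its only blocker or, if there is none, any token outside `S`.
    -- In both cases no token leaves `S`, so the measure drops.
    obtain ⟨x, hxI, hxS, hx⟩ : ∃ x ∈ I, x ∉ S ∧ ∀ y ∈ I, y ≠ x → ¬ G.Adj s y := by
      by_cases h : ∃ x ∈ I, G.Adj s x
      · obtain ⟨x, hxI, hsx⟩ := h
        exact ⟨x, hxI, fun hxS => hS hsS hxS hsx.ne hsx,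
          fun y hy hyx hsy => hyx (hblock s hsS y hy x hxI hsy hsx)⟩
      · push Not at h
        obtain ⟨x, hx⟩ : (I \ S).Nonempty := by
          rw [← Finset.card_pos, Finset.card_sdiff_comm hcard]
          lia
        rw [Finset.mem_sdiff] at hx
        exact ⟨x, hx.1, hx.2, fun y hy _ => h y hy⟩
    have hxs : s ≠ x := fun h => hsI (h ▸ hxI)
    have hsE : s ∉ I.erase x := fun h => hsI (Finset.mem_of_mem_erase h)
    have hI' : G.IsIndepSet ((insert s (I.erase x) : Finset V) : Set V) := by
      rw [Finset.coe_insert, Finset.coe_erase]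
      refine Set.Pairwise.insert (hI.mono Set.sdiff_subset) ?_
      rintro y ⟨hy, hyx⟩ -
      exact ⟨hx y hy hyx, fun h => hx y hy hyx h.symm⟩
    have hstep : Step G I (insert s (I.erase x)) := by
      refine ⟨hI, hI', ?_, ?_⟩
      · rw [Finset.card_eq_one]
        refine ⟨x, ?_⟩
        ext y
        simp only [Finset.mem_sdiff, Finset.mem_insert, Finset.mem_erase, Finset.mem_singleton]
        grind
      · rw [Finset.card_eq_one]
        refine ⟨s, ?_⟩
        ext y
        simp only [Finset.mem_sdiff, Finset.mem_insert, Finset.mem_erase, Finset.mem_singleton]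
        grind
    refine Relation.ReflTransGen.head hstep (ih ?_ hI' hS ?_ ?_)
    · have : S \ insert s (I.erase x) = (S \ I).erase s := by
        ext y
        simp only [Finset.mem_sdiff, Finset.mem_insert, Finset.mem_erase]
        grind
      rw [this, Finset.card_erase_of_mem hs, hn, Nat.add_sub_cancel]
    · rw [Finset.card_insert_of_notMem hsE, Finset.card_erase_add_one hxI, hcard]
    · intro t ht y hy z hz hty htz
      -- The moved token blocks nothing in `S`, because `S` is independent, so no new blockers
      -- arise.
      have hmem : ∀ w ∈ insert s (I.erase x), G.Adj t w → w ∈ I := by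
        intro w hw htw
        obtain rfl | hw := Finset.mem_insert.1 hw
        · exact absurd htw (hS ht hsS htw.ne)
        · exact Finset.mem_of_mem_erase hw
      exact hblock t ht y (hmem y hy hty) z (hmem z hz htz) hty htz

/-- In a graph without `K₂,₃`-minor any two independent sets of size `k` are equivalent if there
are more than `12 * k` vertices. -/
theorem reachable_of_noK23 [Fintype V] (hG : G.NoK23) {I J : Finset V}
    (hI : G.IsIndepSet (I : Set V)) (hJ : G.IsIndepSet (J : Set V)) (hIJ : I.card = J.card)
    (hV : 12 * I.card < Fintype.card V) : Relation.ReflTransGen (Step G) I J := by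
  classical
  set X := I ∪ J with hX
  set C := (Finset.univ \ X).filter fun c => ∃ x ∈ X, ∃ y ∈ X, x ≠ y ∧ G.Adj x c ∧ G.Adj y c
    with hC
  set R := (Finset.univ \ X) \ C with hR
  have hXcard : X.card ≤ 2 * I.card := by
    have := Finset.card_union_le I J
    lia
  have hCcard : C.card ≤ 2 * X.card := by
    refine hG.card_le_two_mul_card ?_ fun c hc => (Finset.mem_filter.1 hc).2
    exact Finset.disjoint_sdiff.mono_right (Finset.filter_subset _ _)
  have hcard : Fintype.card V ≤ X.card + C.card + R.card := by
    have h1 := Finset.card_le_card_sdiff_add_card (s := Finset.univ) (t := X)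
    have h2 := Finset.card_le_card_sdiff_add_card (s := Finset.univ \ X) (t := C)
    rw [Finset.card_univ] at h1
    lia
  obtain ⟨S, hSR, hS, hRS⟩ := hG.exists_isIndepSet R
  obtain ⟨T, hTS, hT⟩ := Finset.exists_subset_card_eq (show I.card ≤ S.card by lia)
  have hTind : G.IsIndepSet (T : Set V) := hS.mono (by exact_mod_cast hTS)
  have hblock : ∀ t ∈ T, ∀ x ∈ X, ∀ y ∈ X, G.Adj t x → G.Adj t y → x = y := by
    intro t ht x hx y hy htx hty
    have htR := Finset.mem_sdiff.1 (hSR (hTS ht))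
    by_contra hxy
    exact htR.2 (Finset.mem_filter.2 ⟨htR.1, x, hx, y, hy, hxy, htx.symm, hty.symm⟩)
  have h1 : Relation.ReflTransGen (Step G) I T :=
    reachable_of_at_most_one_blocker _ rfl hI hTind hT.symm fun t ht x hx y hy =>
      hblock t ht x (Finset.mem_union_left _ hx) y (Finset.mem_union_left _ hy)
  have h2 : Relation.ReflTransGen (Step G) J T :=
    reachable_of_at_most_one_blocker _ rfl hJ hTind (hIJ.symm.trans hT.symm)
      fun t ht x hx y hy =>
        hblock t ht x (Finset.mem_union_right _ hx) y (Finset.mem_union_right _ hy)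
  have : Std.Symm (Step G) := ⟨fun _ _ h => Step.symm h⟩
  exact h1.trans (Relation.ReflTransGen.stdSymm.symm _ _ h2)

end Reconfiguration

/-- The instance without vertices. -/
def Instance.empty : Instance where
  order := 0
  graph := ⊥
  source := ∅
  target := ∅
  source_indep := by simp [SimpleGraph.IsIndepSet]
  target_indep := by simp [SimpleGraph.IsIndepSet]
  card_eq := rfl

theorem Instance.empty_isYes : Instance.empty.IsYes := Relation.ReflTransGen.refl

theorem Instance.encode_empty : Instance.empty.encode = [] := rfl

/-- A graph without vertices is outerplanar. -/
theorem isOuterplanar_of_isEmpty {V : Type*} [IsEmpty V] (G : SimpleGraph V) :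
    G.IsOuterplanar :=
  ⟨{ pos := isEmptyElim
     arc := fun _ => ∅
     pos_injective := fun v => isEmptyElim v
     arc_simple := fun v => isEmptyElim v
     mem_of_pos_mem_arc := fun _ _ w => isEmptyElim w
     arc_inter_arc := fun _ _ _ _ _ _ h => h.1.elim }, fun v => isEmptyElim v⟩

/-- The kernelization: an instance with more than `21 * k` vertices is replaced by a trivial
Yes-instance. -/
def truncate (x : Instance) : Instance :=
  if x.order ≤ 21 * x.param then x else Instance.empty

theorem truncate_spec (x : Instance) (hx : x.graph.IsOuterplanar) :
    (truncate x).graph.IsOuterplanar ∧ ((truncate x).IsYes ↔ x.IsYes) ∧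
      (truncate x).order ≤ 21 * x.param := by
  by_cases h : x.order ≤ 21 * x.param
  · rw [truncate, if_pos h]
    exact ⟨hx, Iff.rfl, h⟩
  · rw [truncate, if_neg h]
    refine ⟨?_, ⟨fun _ => ?_, fun _ => Instance.empty_isYes⟩, Nat.zero_le _⟩
    · have : IsEmpty (Fin Instance.empty.order) := Fin.isEmpty
      exact isOuterplanar_of_isEmpty _
    -- More than `12 * k` vertices would suffice, so the bound `21 * k` leaves room.
    · refine reachable_of_noK23 hx.noK23 x.source_indep x.target_indep x.card_eq ?_
      rw [Fintype.card_fin]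
      unfold Instance.param at h
      lia

end TokenJumping

/-! ### The kernelization is computable in polynomial time -/

namespace TokenJumping

/-- Whether a letter stands for a vertex. -/
def Symbol.isVertex : Symbol → Bool
  | .vertex _ _ => true
  | _ => false

/-- Whether a letter stands for a vertex of the first independent set. -/
def Symbol.isSource : Symbol → Bool
  | .vertex b _ => b
  | _ => false

/-- The matrix letters do not contribute, so the order and the parameter can be read off by counting
letters of the whole word. -/
theorem Instance.countP_encode (x : Instance) (f : Symbol → Bool) (hrow : f .row = false)
    (hentry : ∀ b, f (.entry b) = false) :
    x.encode.countP f = (List.ofFn fun v : Fin x.order =>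
      Symbol.vertex (decide (v ∈ x.source)) (decide (v ∈ x.target))).countP f := by
  rw [Instance.encode, List.countP_append, Nat.add_eq_left, List.countP_eq_zero]
  intro s hs
  simp only [List.mem_flatten, List.mem_ofFn] at hs
  obtain ⟨l, ⟨u, rfl⟩, hs⟩ := hs
  simp only [Instance.encodeRow, List.mem_cons, List.mem_ofFn] at hs
  rcases hs with rfl | ⟨v, rfl⟩ <;> simp [hrow, hentry]

theorem Instance.countP_isVertex_encode (x : Instance) :
    x.encode.countP Symbol.isVertex = x.order := by
  rw [x.countP_encode _ rfl fun _ => rfl, List.countP_eq_length.2, List.length_ofFn]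
  intro s hs
  obtain ⟨v, rfl⟩ := List.mem_ofFn.1 hs
  rfl

theorem Instance.countP_isSource_encode (x : Instance) :
    x.encode.countP Symbol.isSource = x.param := by
  rw [x.countP_encode _ rfl fun _ => rfl, List.ofFn_eq_map, List.countP_map, Instance.param,
    List.countP_eq_length_filter, ← List.toFinset_card_of_nodup ((List.nodup_finRange _).filter _)]
  congr 1
  ext v
  simp [Symbol.isSource]

/-! ### A stack machine for the size test -/

namespace Truncation

open Turing Turing.TM2 StateTransition

/-- The stacks of the machine: the tape, which holds input and output, a copy of the tape, and a
counter. -/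
inductive Stack
  | tape
  | copy
  | counter
  deriving DecidableEq

instance : Fintype Stack :=
  ⟨{.tape, .copy, .counter}, fun x => by cases x <;> decide⟩

/-- The phases of the machine: copy the tape and count `21` for each token of the first
independent set, copy back and discount `1` for each vertex, empty the counter, empty the tape. -/
inductive Phase
  | count
  | discount
  | clear
  | wipe
  deriving DecidableEq

instance : Fintype Phase :=
  ⟨{.count, .discount, .clear, .wipe}, fun x => by cases x <;> decide⟩

/-- The internal state: the letter read last, and whether there are too many vertices. -/
abbrev State := Option Symbol × Bool

/-- The statements of the machine. -/
abbrev Statement := Stmt (fun _ : Stack => Symbol) Phase State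

/-- Push `n` units on the counter. -/
def pushUnits : ℕ → Statement → Statement
  | 0, q => q
  | n + 1, q => .push .counter (fun _ => .row) (pushUnits n q)

/-- The program of the machine. -/
def program : Phase → Statement
  | .count =>
    .pop .tape (fun v s => (s, v.2)) <| .branch (fun v => v.1.isNone) (.goto fun _ => .discount) <|
      .push .copy (fun v => v.1.getD .row) <| .branch (fun v => (v.1.getD .row).isSource)
        (pushUnits 21 (.goto fun _ => .count)) (.goto fun _ => .count)
  | .discount =>
    .pop .copy (fun v s => (s, v.2)) <| .branch (fun v => v.1.isNone) (.goto fun _ => .clear) <|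
      .push .tape (fun v => v.1.getD .row) <| .branch (fun v => (v.1.getD .row).isVertex)
        (.pop .counter (fun v s => (v.1, v.2 || s.isNone)) (.goto fun _ => .discount))
        (.goto fun _ => .discount)
  -- A halting configuration must have the initial internal state and empty auxiliary stacks; hence
  -- the counter is emptied and the flag reset.
  | .clear =>
    .pop .counter (fun v s => (s, v.2)) <| .branch (fun v => v.1.isNone)
      (.branch (fun v => v.2) (.load (fun _ => (none, false)) (.goto fun _ => .wipe)) .halt)
      (.goto fun _ => .clear)
  | .wipe =>
    .pop .tape (fun v s => (s, v.2)) <| .branch (fun v => v.1.isNone) .halt (.goto fun _ => .wipe)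

/-- The machine that empties its tape if there are too many vertices. -/
def machine : FinTM2 where
  K := Stack
  k₀ := .tape
  k₁ := .tape
  Γ _ := Symbol
  Λ := Phase
  main := .count
  σ := State
  initialState := (none, false)
  Γk₀Fin := inferInstanceAs (Fintype Symbol)
  m := program

/-- The contents of the three stacks. -/
def contents (a b c : List Symbol) : Stack → List Symbol
  | .tape => a
  | .copy => b
  | .counter => c

/-! ### Runs of the machine and their lengths -/

theorem update_tape (a b c d : List Symbol) :
    Function.update (contents a b c) .tape d = contents d b c := by
  funext k; cases k <;> rfl

theorem update_copy (a b c d : List Symbol) :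
    Function.update (contents a b c) .copy d = contents a d c := by
  funext k; cases k <;> rfl

theorem update_counter (a b c d : List Symbol) :
    Function.update (contents a b c) .counter d = contents a b d := by
  funext k; cases k <;> rfl

/-- A configuration of the machine. -/
def cfg (l : Option Phase) (v : State) (a b c : List Symbol) : machine.Cfg :=
  (⟨l, v, contents a b c⟩ : Cfg (fun _ : Stack => Symbol) Phase State)

/-- The machine arrives at the second configuration after `n` steps. -/
def Runs (n : ℕ) (x y : machine.Cfg) : Prop :=
  (flip bind machine.step)^[n] (some x) = some y

theorem Runs.trans {m n : ℕ} {x y z : machine.Cfg} (h : Runs m x y) (h' : Runs n y z) :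
    Runs (n + m) x z := by
  unfold Runs at *
  rw [Function.iterate_add_apply, h, h']

/-- One step executes a whole statement up to its jump or halt, so pushing `21` units costs no extra
steps. -/
theorem runs_one {l : Phase} {v : State} {a b c : List Symbol} {y : machine.Cfg}
    (h : stepAux (program l) v (contents a b c) = y) : Runs 1 (cfg (some l) v a b c) y := by
  subst h
  rfl

theorem stepAux_pushUnits (n : ℕ) (q : Statement) (v : State) (a b c : List Symbol) :
    stepAux (pushUnits n q) v (contents a b c) =
      stepAux q v (contents a b (List.replicate n .row ++ c)) := by
  induction n generalizing c with
  | zero => rfl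
  | succ n ih =>
    rw [pushUnits, stepAux, update_counter, ih, List.replicate_succ', List.append_assoc]
    rfl

theorem runs_count (a b : List Symbol) (n : ℕ) (v : State) :
    Runs (a.length + 1) (cfg (some .count) v a b (List.replicate n .row))
      (cfg (some .discount) (none, v.2) [] (a.reverse ++ b)
        (List.replicate (21 * a.countP Symbol.isSource + n) .row)) := by
  induction a generalizing b n v with
  | nil =>
    refine runs_one ?_
    simp [program, stepAux, update_tape, contents, cfg]
  | cons s a ih =>
    have h1 : Runs 1 (cfg (some .count) v (s :: a) b (List.replicate n .row))
        (cfg (some .count) (some s, v.2) a (s :: b)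
          (List.replicate ((if s.isSource then 21 else 0) + n) .row)) := by
      refine runs_one ?_
      cases hs : s.isSource <;>
        simp [program, stepAux, update_tape, update_copy, contents, cfg, hs, stepAux_pushUnits,
          List.replicate_add]
    convert h1.trans (ih (s :: b) _ (some s, v.2)) using 2
    · simp
    · simp
    · rw [List.countP_cons]
      congr 1
      split_ifs <;> lia

/-- The flag is raised exactly when a vertex finds the counter empty, which is why the truncated
subtraction loses no information. This pass also undoes the reversal caused by the copying. -/
theorem runs_discount (b a : List Symbol) (n : ℕ) (v : State) :
    Runs (b.length + 1) (cfg (some .discount) v a b (List.replicate n .row))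
      (cfg (some .clear) (none, v.2 || decide (n < b.countP Symbol.isVertex)) (b.reverse ++ a) []
        (List.replicate (n - b.countP Symbol.isVertex) .row)) := by
  induction b generalizing a n v with
  | nil =>
    refine runs_one ?_
    simp [program, stepAux, update_copy, contents, cfg]
  | cons s b ih =>
    have h1 : Runs 1 (cfg (some .discount) v a (s :: b) (List.replicate n .row))
        (cfg (some .discount) (some s, v.2 || (s.isVertex && decide (n = 0))) (s :: a) b
          (List.replicate (n - if s.isVertex then 1 else 0) .row)) := by
      refine runs_one ?_
      cases hs : s.isVertex <;> cases n <;>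
        simp [program, stepAux, update_tape, update_copy, update_counter, contents, cfg, hs,
          List.replicate_succ]
    convert h1.trans (ih (s :: a) _ (some s, v.2 || (s.isVertex && decide (n = 0)))) using 2
    · simp
    · rw [List.countP_cons, Bool.or_assoc]
      congr 2
      cases s.isVertex
      · simp
      · rw [Bool.true_and, ← Bool.decide_or, decide_eq_decide, if_pos rfl]
        lia
    · simp
    · rw [List.countP_cons]
      congr 1
      split_ifs <;> lia

theorem runs_clear (n : ℕ) (a : List Symbol) (v : State) :
    Runs (n + 1) (cfg (some .clear) v a [] (List.replicate n .row))
      (cfg (if v.2 then some .wipe else none) (none, false) a [] []) := by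
  induction n generalizing v with
  | zero =>
    refine runs_one ?_
    obtain ⟨s, _ | _⟩ := v <;> simp [program, stepAux, update_counter, contents, cfg]
  | succ n ih =>
    have h1 : Runs 1 (cfg (some .clear) v a [] (List.replicate (n + 1) .row))
        (cfg (some .clear) (some .row, v.2) a [] (List.replicate n .row)) := by
      refine runs_one ?_
      simp [program, stepAux, update_counter, contents, cfg, List.replicate_succ]
    exact h1.trans (ih (some .row, v.2))

theorem runs_wipe (a : List Symbol) (s : Option Symbol) :
    Runs (a.length + 1) (cfg (some .wipe) (s, false) a [] [])
      (cfg none (none, false) [] [] []) := by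
  induction a generalizing s with
  | nil =>
    refine runs_one ?_
    simp [program, stepAux, update_tape, contents, cfg]
  | cons t a ih =>
    have h1 : Runs 1 (cfg (some .wipe) (s, false) (t :: a) [] [])
        (cfg (some .wipe) (some t, false) a [] []) := by
      refine runs_one ?_
      simp [program, stepAux, update_tape, contents, cfg]
    exact h1.trans (ih (some t))

/-- The three passes over the word cost `w.length + 1` steps each and emptying the counter at most
`21 * w.length + 1`, which adds up to the bound. -/
theorem exists_runs (w : List Symbol) :
    ∃ n ≤ 24 * w.length + 4, Runs n (cfg (some .count) (none, false) w [] [])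
      (cfg none (none, false)
        (if w.countP Symbol.isVertex ≤ 21 * w.countP Symbol.isSource then w else []) [] []) := by
  have h1 := runs_count w [] 0 (none, false)
  rw [List.append_nil, Nat.add_zero] at h1
  have h2 := runs_discount w.reverse [] (21 * w.countP Symbol.isSource) (none, false)
  rw [List.reverse_reverse, List.append_nil, List.countP_reverse, List.length_reverse] at h2
  have h3 := (h1.trans h2).trans (runs_clear _ _ _)
  have hle : w.countP Symbol.isSource ≤ w.length := List.countP_le_length
  by_cases h : w.countP Symbol.isVertex ≤ 21 * w.countP Symbol.isSource
  · rw [if_pos h]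
    simp only [Bool.false_or, decide_eq_false (not_lt.2 h)] at h3
    exact ⟨_, by lia, h3⟩
  · rw [if_neg h]
    simp only [Bool.false_or, decide_eq_true (not_le.1 h)] at h3
    exact ⟨_, by lia, h3.trans (runs_wipe w none)⟩

theorem initList_machine (w : List Symbol) :
    initList machine w = cfg (some .count) (none, false) w [] [] := by
  unfold initList cfg
  congr 1
  funext k
  cases k <;> rfl

theorem haltList_machine (w : List Symbol) :
    haltList machine w = cfg none (none, false) w [] [] := by
  unfold haltList cfg
  congr 1
  funext k
  cases k <;> rfl

end Truncation

open Truncation in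
/-- The kernelization is computable in linear time. -/
theorem truncate_polyTime :
    Nonempty (Turing.TM2ComputableInPolyTime Instance.encode Instance.encode truncate) := by
  have key : ∀ x : Instance, Nonempty (Turing.TM2OutputsInTime machine x.encode
      (some (truncate x).encode) ((24 * Polynomial.X + 4 : Polynomial ℕ).eval x.encode.length)) := by
    intro x
    obtain ⟨n, hn, h⟩ := exists_runs x.encode
    refine ⟨⟨⟨n, ?_⟩, ?_⟩⟩
    · have henc : (truncate x).encode =
          if x.encode.countP Symbol.isVertex ≤ 21 * x.encode.countP Symbol.isSource
            then x.encode else [] := by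
        rw [x.countP_isVertex_encode, x.countP_isSource_encode, truncate]
        split_ifs
        · rfl
        · exact Instance.encode_empty
      rw [initList_machine, henc]
      refine Eq.trans h ?_
      rw [← haltList_machine]
      rfl
    · simpa using hn
  refine ⟨{
    tm := machine
    inputAlphabet := Equiv.refl Symbol
    outputAlphabet := Equiv.refl Symbol
    time := 24 * Polynomial.X + 4
    outputsFun := fun x => ?_ }⟩
  have hmap : ∀ l : List Symbol, l.map (Equiv.refl Symbol).invFun = l := fun l => List.map_id l
  exact (hmap x.encode).symm ▸ (hmap (truncate x).encode).symm ▸ (key x).some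

end TokenJumping

theorem mainTheorem4 :
    ∃ K : TokenJumping.Instance → TokenJumping.Instance,
      TokenJumping.IsKernelization (fun _ G => G.IsOuterplanar) (fun k => 21 * k) K := by
  exact ⟨TokenJumping.truncate, TokenJumping.truncate_polyTime, TokenJumping.truncate_spec⟩
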